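/- Let $N\ge 4$, $2^*=\frac{2N}{N-2}$, let $\Omega\subset\mathbb{R}^N$ be a bounded domain (a nonempty, connected, bounded open set), let $A=(A_1,\dots,A_N):\mathbb{R}^N\to\mathbb{R}^N$ be continuous and bounded, and let $\mu>0$. For complex-valued $u$ put $\nabla_{A_\mu}u=(D_1u,\dots,D_Nu)$ with $D_ju(x)=-i\,\partial_ju(x)-A_j(\mu x)\,u(x)$. Let $H^1_0(\Omega,\mathbb{R})$ be the usual real Sobolev space (the closure of $C_c^\infty(\Omega,\mathbb{R})$ in the $H^1$ norm), and let $H^1_0(\Omega,\mathbb{C})\subset L^2(\Omega,\mathbb{C})$ be the closure of $C_c^\infty(\Omega,\mathbb{C})$ under the norm $\|u\|_{A_\mu}=\left(\int_\Omega|\nabla_{A_\mu}u|^2\,dx\right)^{1/2}$, that is, the set of $u\in L^2(\Omega,\mathbb{C})$ with weak gradient in $L^2$ which are limits, both in $L^2$ and in $\|\cdot\|_{A_\mu}$, of a sequence in $C_c^\infty(\Omega,\mathbb{C})$. Define the best Sobolev constant and the best magnetic Sobolev constant $$S=\inf_{u\in H^1_0(\Omega,\mathbb{R})\setminus\{0\}}\frac{\int_\Omega|\nabla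 u|^2\,dx}{\left(\int_\Omega|u|^{2^*}dx\right)^{2/2^*}},\qquad S_{A_\mu}=\inf_{u\in H^1_0(\Omega,\mathbb{C})\setminus\{0\}}\frac{\int_\Omega|\nabla_{A_\mu}u|^2\,dx}{\left(\int_\Omega|u|^{2^*}dx\right)^{2/2^*}}.$$ Then $S=S_{A_\mu}$. -/

import Mathlib

open MeasureTheory Filter Topology
open scoped ENNReal Distributions

noncomputable section

namespace MagneticSobolev

/-- The critical exponent `2^* = 2N/(N-2)`, a real number (used for `N ≥ 4`). -/
def critExp (N : ℕ) : ℝ := 2 * (N : ℝ) / ((N : ℝ) - 2)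

/-- The classical gradient `(∂₁φ, …, ∂_Nφ)` of a (real or complex valued) function on `ℝ^N`. -/
def grad {N : ℕ} {𝕜 : Type} [RCLike 𝕜] (φ : EuclideanSpace ℝ (Fin N) → 𝕜)
    (x : EuclideanSpace ℝ (Fin N)) : EuclideanSpace 𝕜 (Fin N) :=
  WithLp.toLp 2 fun j => fderiv ℝ φ x (EuclideanSpace.single j 1)

/-- `g` is the weak (distributional) gradient of `u` on the open set `Ω`: both are locally
integrable on `Ω` and `∫_Ω (∂_j φ) u = - ∫_Ω φ g_j` for every `j` and every real-valued
`φ ∈ C_c^∞(Ω)`. It is unique up to equality almost everywhere on `Ω`. -/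
structure IsWeakGrad {N : ℕ} {𝕜 : Type} [RCLike 𝕜]
    (Ω : TopologicalSpace.Opens (EuclideanSpace ℝ (Fin N)))
    (u : EuclideanSpace ℝ (Fin N) → 𝕜)
    (g : EuclideanSpace ℝ (Fin N) → EuclideanSpace 𝕜 (Fin N)) : Prop where
  locallyIntegrableOn : LocallyIntegrableOn u (Ω : Set (EuclideanSpace ℝ (Fin N))) volume
  locallyIntegrableOn_grad : LocallyIntegrableOn g (Ω : Set (EuclideanSpace ℝ (Fin N))) volume
  integral_eq : ∀ (φ : 𝓓(Ω, ℝ)) (j : Fin N),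
    ∫ x in (Ω : Set (EuclideanSpace ℝ (Fin N))), grad φ x j • u x
      = -∫ x in (Ω : Set (EuclideanSpace ℝ (Fin N))), φ x • g x j

/-- `u ∈ H¹₀(Ω, ℝ)`, with weak gradient `g`: `u` and its weak gradient `g` are in `L²(Ω)`, and `u`
is the limit in the `H¹` norm of a sequence of real functions in `C_c^∞(Ω)`. -/
structure MemH10 {N : ℕ}
    (Ω : TopologicalSpace.Opens (EuclideanSpace ℝ (Fin N)))
    (u : EuclideanSpace ℝ (Fin N) → ℝ)
    (g : EuclideanSpace ℝ (Fin N) → EuclideanSpace ℝ (Fin N)) : Prop where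
  memLp : MemLp u 2 (volume.restrict (Ω : Set (EuclideanSpace ℝ (Fin N))))
  memLp_grad : MemLp g 2 (volume.restrict (Ω : Set (EuclideanSpace ℝ (Fin N))))
  isWeakGrad : IsWeakGrad Ω u g
  exists_approx : ∃ φ : ℕ → 𝓓(Ω, ℝ),
    Tendsto (fun n => eLpNorm (fun x => φ n x - u x) 2
      (volume.restrict (Ω : Set (EuclideanSpace ℝ (Fin N))))) atTop (𝓝 0) ∧
    Tendsto (fun n => eLpNorm (fun x => grad (φ n) x - g x) 2
      (volume.restrict (Ω : Set (EuclideanSpace ℝ (Fin N))))) atTop (𝓝 0)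

/-- The magnetic gradient `∇_{A_μ} u = (D₁u, …, D_N u)`, `D_j u = -i ∂_j u - A_j(μ x) u`,
of a complex function `u` whose (classical or weak) gradient is `g`. -/
def magGrad {N : ℕ} (A : EuclideanSpace ℝ (Fin N) → EuclideanSpace ℝ (Fin N)) (μ : ℝ)
    (u : EuclideanSpace ℝ (Fin N) → ℂ)
    (g : EuclideanSpace ℝ (Fin N) → EuclideanSpace ℂ (Fin N))
    (x : EuclideanSpace ℝ (Fin N)) : EuclideanSpace ℂ (Fin N) :=
  WithLp.toLp 2 fun j => -Complex.I * g x j - (A (μ • x) j : ℂ) * u x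

/-- `u ∈ H¹₀(Ω, ℂ)`, with weak gradient `g`: `H¹₀(Ω, ℂ)` is the closure of `C_c^∞(Ω, ℂ)` under the
norm `‖u‖_{A_μ} = (∫_Ω |∇_{A_μ} u|²)^{1/2}`, realised as a space of functions in `L²(Ω, ℂ)`: `u` is
the limit, in `L²(Ω, ℂ)` and in `‖·‖_{A_μ}`, of a sequence in `C_c^∞(Ω, ℂ)`. (On a bounded `Ω`
a sequence in `C_c^∞(Ω, ℂ)` which is Cauchy for `‖·‖_{A_μ}` is Cauchy in `L²`, so that this is the
completion.) -/
structure MemMagH10 {N : ℕ} (A : EuclideanSpace ℝ (Fin N) → EuclideanSpace ℝ (Fin N)) (μ : ℝ)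
    (Ω : TopologicalSpace.Opens (EuclideanSpace ℝ (Fin N)))
    (u : EuclideanSpace ℝ (Fin N) → ℂ)
    (g : EuclideanSpace ℝ (Fin N) → EuclideanSpace ℂ (Fin N)) : Prop where
  memLp : MemLp u 2 (volume.restrict (Ω : Set (EuclideanSpace ℝ (Fin N))))
  memLp_grad : MemLp g 2 (volume.restrict (Ω : Set (EuclideanSpace ℝ (Fin N))))
  isWeakGrad : IsWeakGrad Ω u g
  exists_approx : ∃ φ : ℕ → 𝓓(Ω, ℂ),
    Tendsto (fun n => eLpNorm (fun x => φ n x - u x) 2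
      (volume.restrict (Ω : Set (EuclideanSpace ℝ (Fin N))))) atTop (𝓝 0) ∧
    Tendsto (fun n => eLpNorm
      (fun x => magGrad A μ (φ n) (grad (φ n)) x - magGrad A μ u g x) 2
      (volume.restrict (Ω : Set (EuclideanSpace ℝ (Fin N))))) atTop (𝓝 0)

/-- The best Sobolev constant
`S = inf { ∫_Ω |∇u|² / (∫_Ω |u|^{2^*})^{2/2^*} : u ∈ H¹₀(Ω, ℝ), u ≠ 0 }`,
as an element of `[0, ∞]`. The pair `(u, g)` runs over the functions with their weak gradients. -/
def sobolevConst {N : ℕ} (Ω : TopologicalSpace.Opens (EuclideanSpace ℝ (Fin N))) : ℝ≥0∞ :=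
  ⨅ (u : EuclideanSpace ℝ (Fin N) → ℝ)
    (g : EuclideanSpace ℝ (Fin N) → EuclideanSpace ℝ (Fin N))
    (_ : MemH10 Ω u g)
    (_ : ¬ u =ᵐ[volume.restrict (Ω : Set (EuclideanSpace ℝ (Fin N)))] 0),
    (∫⁻ x in (Ω : Set (EuclideanSpace ℝ (Fin N))), ‖g x‖ₑ ^ 2) /
      (∫⁻ x in (Ω : Set (EuclideanSpace ℝ (Fin N))), ‖u x‖ₑ ^ critExp N) ^ (2 / critExp N)

/-- The best magnetic Sobolev constant
`S_{A_μ} = inf { ∫_Ω |∇_{A_μ} u|² / (∫_Ω |u|^{2^*})^{2/2^*} : u ∈ H¹₀(Ω, ℂ), u ≠ 0 }`,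
as an element of `[0, ∞]`. -/
def magSobolevConst {N : ℕ} (A : EuclideanSpace ℝ (Fin N) → EuclideanSpace ℝ (Fin N)) (μ : ℝ)
    (Ω : TopologicalSpace.Opens (EuclideanSpace ℝ (Fin N))) : ℝ≥0∞ :=
  ⨅ (u : EuclideanSpace ℝ (Fin N) → ℂ)
    (g : EuclideanSpace ℝ (Fin N) → EuclideanSpace ℂ (Fin N))
    (_ : MemMagH10 A μ Ω u g)
    (_ : ¬ u =ᵐ[volume.restrict (Ω : Set (EuclideanSpace ℝ (Fin N)))] 0),
    (∫⁻ x in (Ω : Set (EuclideanSpace ℝ (Fin N))), ‖magGrad A μ u g x‖ₑ ^ 2) /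
      (∫⁻ x in (Ω : Set (EuclideanSpace ℝ (Fin N))), ‖u x‖ₑ ^ critExp N) ^ (2 / critExp N)

end MagneticSobolev

end

/-! Both inequalities are proved for test functions, in the product form `c * (∫|φ|^p)^(2/p) ≤
energy`, and then carried to the closure by Fatou's lemma
(`mul_lintegral_rpow_le_of_tendsto_eLpNorm`).

`S ≤ S_A` is the diamagnetic inequality `|∇|φ|| ≤ |∇_A φ|`. Since `|φ|` need not be smooth, it is
replaced by `√(|φ|² + ε²) - ε`, and `ε → 0` (`norm_grad_regAbs_le`, `sobolevConst_mul_le_magGrad`).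

`S_A ≤ S` comes from concentration: for real `φ` the energy of `φ((x - x₀)/σ)` has no cross term.
Its gradient part scales like `σ^(N-2)`, exactly as the squared `L^{2*}` norm, while the part
carrying the bounded `A` is of order `σ^N` and disappears as `σ → 0`
(`magSobolevConst_mul_le_grad`). No minimiser is needed. -/

noncomputable section

namespace MagneticSobolev

/-! ### Passing Sobolev inequalities to limits. -/

section Fatou

variable {X F F' : Type*} [MeasurableSpace X] {ν : Measure X} [NormedAddCommGroup F]
  [NormedAddCommGroup F']

/-- Fatou's lemma for inequalities of Sobolev type. -/
theorem mul_lintegral_rpow_le_of_tendsto_ae {u : ℕ → X → F} {v : X → F} {p r : ℝ}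
    (hr : 0 < r) {c b : ℝ≥0∞} {B : ℕ → ℝ≥0∞} (hu : ∀ n, AEStronglyMeasurable (u n) ν)
    (huv : ∀ᵐ x ∂ν, Tendsto (fun n => u n x) atTop (𝓝 (v x)))
    (hB : Tendsto B atTop (𝓝 b)) (h : ∀ n, c * (∫⁻ x, ‖u n x‖ₑ ^ p ∂ν) ^ r ≤ B n) :
    c * (∫⁻ x, ‖v x‖ₑ ^ p ∂ν) ^ r ≤ b := by
  -- Taking the power `1/r` makes the integral appear linearly, so that Fatou applies.
  have key : c ^ r⁻¹ * ∫⁻ x, ‖v x‖ₑ ^ p ∂ν ≤ b ^ r⁻¹ := by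
    have h1 : ∫⁻ x, ‖v x‖ₑ ^ p ∂ν ≤ liminf (fun n => ∫⁻ x, ‖u n x‖ₑ ^ p ∂ν) atTop := by
      calc ∫⁻ x, ‖v x‖ₑ ^ p ∂ν = ∫⁻ x, liminf (fun n => ‖u n x‖ₑ ^ p) atTop ∂ν := by
            refine lintegral_congr_ae ?_
            filter_upwards [huv] with x hx
            exact (((ENNReal.continuous_rpow_const.tendsto _).comp
              ((continuous_enorm.tendsto _).comp hx)).liminf_eq).symm
        _ ≤ _ := lintegral_liminf_le' fun n => (hu n).enorm.pow_const p
    calc c ^ r⁻¹ * ∫⁻ x, ‖v x‖ₑ ^ p ∂ν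
        ≤ c ^ r⁻¹ * liminf (fun n => ∫⁻ x, ‖u n x‖ₑ ^ p ∂ν) atTop := by gcongr
      _ ≤ liminf (fun n => c ^ r⁻¹ * ∫⁻ x, ‖u n x‖ₑ ^ p ∂ν) atTop := by
          -- `c` may be `∞`, so continuity of multiplication is not available; only this one
          -- inequality is needed.
          rw [liminf_eq_iSup_iInf_of_nat, liminf_eq_iSup_iInf_of_nat, ENNReal.mul_iSup]
          refine iSup_mono fun n => le_iInf₂ fun i hi => ?_
          gcongr
          exact iInf₂_le i hi
      _ ≤ liminf (fun n => B n ^ r⁻¹) atTop := by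
          refine liminf_le_liminf (Eventually.of_forall fun n => ?_)
          have := ENNReal.rpow_le_rpow (h n) (inv_nonneg.2 hr.le)
          rwa [ENNReal.mul_rpow_of_nonneg _ _ (inv_nonneg.2 hr.le), ENNReal.rpow_rpow_inv hr.ne']
            at this
      _ = b ^ r⁻¹ := ((ENNReal.continuous_rpow_const.tendsto _).comp hB).liminf_eq
  have := ENNReal.rpow_le_rpow key hr.le
  rwa [ENNReal.mul_rpow_of_nonneg _ _ hr.le, ENNReal.rpow_inv_rpow hr.ne',
    ENNReal.rpow_inv_rpow hr.ne'] at this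

theorem eLpNorm_two_sq_eq_lintegral (f : X → F) :
    eLpNorm f 2 ν ^ 2 = ∫⁻ x, ‖f x‖ₑ ^ 2 ∂ν := by
  rw [eLpNorm_eq_lintegral_rpow_enorm_toReal two_ne_zero ENNReal.ofNat_ne_top,
    ← ENNReal.rpow_natCast, ← ENNReal.rpow_mul]
  simp

/-- A subsequence converges almost everywhere, which handles the left side; the triangle inequality
bounds the right side by quantities tending to `‖H‖₂²`. -/
theorem mul_lintegral_rpow_le_of_tendsto_eLpNorm {u : ℕ → X → F} {v : X → F} {G : ℕ → X → F'}
    {H : X → F'} {p r : ℝ} (hr : 0 < r) {c : ℝ≥0∞}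
    (hu : ∀ n, AEStronglyMeasurable (u n) ν) (hv : AEStronglyMeasurable v ν)
    (hG : ∀ n, AEStronglyMeasurable (G n) ν) (hH : AEStronglyMeasurable H ν)
    (huv : Tendsto (fun n => eLpNorm (fun x => u n x - v x) 2 ν) atTop (𝓝 0))
    (hGH : Tendsto (fun n => eLpNorm (fun x => G n x - H x) 2 ν) atTop (𝓝 0))
    (h : ∀ n, c * (∫⁻ x, ‖u n x‖ₑ ^ p ∂ν) ^ r ≤ ∫⁻ x, ‖G n x‖ₑ ^ 2 ∂ν) :
    c * (∫⁻ x, ‖v x‖ₑ ^ p ∂ν) ^ r ≤ ∫⁻ x, ‖H x‖ₑ ^ 2 ∂ν := by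
  obtain ⟨ns, hns, hae⟩ := (tendstoInMeasure_of_tendsto_eLpNorm two_ne_zero hu hv
    huv).exists_seq_tendsto_ae
  refine mul_lintegral_rpow_le_of_tendsto_ae (u := fun n => u (ns n))
    (B := fun n => (eLpNorm (fun x => G (ns n) x - H x) 2 ν + eLpNorm H 2 ν) ^ 2) hr
    (fun n => hu _) hae ?_ fun n => (h _).trans ?_
  · have := ((ENNReal.continuous_pow 2).tendsto _).comp
      ((hGH.comp hns.tendsto_atTop).add_const (eLpNorm H 2 ν))
    rwa [zero_add, eLpNorm_two_sq_eq_lintegral] at this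
  · rw [← eLpNorm_two_sq_eq_lintegral]
    gcongr
    calc eLpNorm (G (ns n)) 2 ν = eLpNorm ((fun x => G (ns n) x - H x) + H) 2 ν := by
          congr 1; ext x; simp
      _ ≤ _ := eLpNorm_add_le ((hG _).sub hH) hH (by norm_num)

/-- Nonvanishing of `v` makes the denominator positive, and `a ≠ ∞` excludes `∞ / ∞ = 0`. -/
theorem le_div_of_mul_lintegral_rpow_le {v : X → F} {p r : ℝ} (hp : 0 < p) (hr : 0 < r)
    {c a : ℝ≥0∞} (hv : AEStronglyMeasurable v ν) (hv0 : ¬ v =ᵐ[ν] 0) (ha : a ≠ ∞)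
    (h : c * (∫⁻ x, ‖v x‖ₑ ^ p ∂ν) ^ r ≤ a) : c ≤ a / (∫⁻ x, ‖v x‖ₑ ^ p ∂ν) ^ r := by
  rw [ENNReal.le_div_iff_mul_le (Or.inl ?_) (Or.inr ha)]
  · exact h
  · intro h0
    rw [ENNReal.rpow_eq_zero_iff_of_pos hr, lintegral_eq_zero_iff' (hv.enorm.pow_const p)] at h0
    apply hv0
    filter_upwards [h0] with x hx
    simpa [hp, hp.not_gt] using hx

end Fatou

/-! ### Test functions as competitors in both infima. -/

section TestFunctions

variable {N : ℕ} {𝕜 : Type} [RCLike 𝕜] {Ω : TopologicalSpace.Opens (EuclideanSpace ℝ (Fin N))}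

theorem continuous_grad (φ : 𝓓(Ω, 𝕜)) : Continuous (grad φ) := by
  have : Continuous (fderiv ℝ φ) := φ.contDiff.continuous_fderiv (by simp)
  unfold grad
  fun_prop

theorem support_grad_subset (φ : 𝓓(Ω, 𝕜)) : Function.support (grad φ) ⊆ tsupport φ := by
  refine Function.support_subset_iff'.2 fun x hx => ?_
  have : fderiv ℝ φ x = 0 := by
    by_contra h
    exact hx (support_fderiv_subset ℝ (Function.mem_support.2 h))
  ext j
  simp [grad, this]

theorem hasCompactSupport_grad (φ : 𝓓(Ω, 𝕜)) : HasCompactSupport (grad φ) :=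
  φ.hasCompactSupport.mono' (support_grad_subset φ)

theorem memLp_testFunction (φ : 𝓓(Ω, 𝕜)) : MemLp φ 2 (volume.restrict (Ω : Set _)) :=
  (φ.continuous.memLp_of_hasCompactSupport φ.hasCompactSupport).restrict _

theorem memLp_grad_testFunction (φ : 𝓓(Ω, 𝕜)) : MemLp (grad φ) 2 (volume.restrict (Ω : Set _)) :=
  ((continuous_grad φ).memLp_of_hasCompactSupport (hasCompactSupport_grad φ)).restrict _

theorem isWeakGrad_testFunction (φ : 𝓓(Ω, 𝕜)) : IsWeakGrad Ω φ (grad φ) where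
  locallyIntegrableOn := φ.continuous.locallyIntegrable.locallyIntegrableOn _
  locallyIntegrableOn_grad := (continuous_grad φ).locallyIntegrable.locallyIntegrableOn _
  integral_eq ψ j := by
    have hφ : Continuous (fderiv ℝ φ) := φ.contDiff.continuous_fderiv (by simp)
    have hψ : Continuous (fderiv ℝ ψ) := ψ.contDiff.continuous_fderiv (by simp)
    have hφd : Differentiable ℝ φ := φ.contDiff.differentiable (by simp)
    have hψd : Differentiable ℝ ψ := ψ.contDiff.differentiable (by simp)
    have h0 : ∀ x, x ∉ (Ω : Set _) → φ x = 0 := fun x hx =>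
      image_eq_zero_of_notMem_tsupport fun h => hx (φ.tsupport_subset h)
    have h1 : ∀ x, x ∉ (Ω : Set _) → ψ x = 0 := fun x hx =>
      image_eq_zero_of_notMem_tsupport fun h => hx (ψ.tsupport_subset h)
    -- Both integrands vanish off `Ω`, so integration by parts takes place on the whole space,
    -- without boundary terms.
    rw [setIntegral_eq_integral_of_forall_compl_eq_zero fun x hx => by simp [h0 x hx],
      setIntegral_eq_integral_of_forall_compl_eq_zero fun x hx => by simp [h1 x hx]]
    have := integral_bilinear_fderiv_right_eq_neg_left_of_integrable (μ := volume)
      (f := ψ) (g := φ) (v := EuclideanSpace.single j (1 : ℝ)) (B := ContinuousLinearMap.lsmul ℝ ℝ)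
      ?_ ?_ ?_ (fun x _ => hψd x) (fun x _ => hφd x)
    · simp only [ContinuousLinearMap.lsmul_apply] at this
      simp only [grad]
      rw [this, neg_neg]
    · refine Continuous.integrable_of_hasCompactSupport (by simp; fun_prop) ?_
      exact φ.hasCompactSupport.mono fun x hx h => hx (by simp [h])
    · refine Continuous.integrable_of_hasCompactSupport (by simp; fun_prop) ?_
      exact ψ.hasCompactSupport.mono fun x hx h => hx (by simp [h])
    · refine Continuous.integrable_of_hasCompactSupport (by simp; fun_prop) ?_
      exact ψ.hasCompactSupport.mono fun x hx h => hx (by simp [h])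

theorem memH10_testFunction (φ : 𝓓(Ω, ℝ)) : MemH10 Ω φ (grad φ) where
  memLp := memLp_testFunction φ
  memLp_grad := memLp_grad_testFunction φ
  isWeakGrad := isWeakGrad_testFunction φ
  exists_approx := ⟨fun _ => φ, by simp, by simp⟩

theorem memMagH10_testFunction (A : EuclideanSpace ℝ (Fin N) → EuclideanSpace ℝ (Fin N)) (μ : ℝ)
    (φ : 𝓓(Ω, ℂ)) : MemMagH10 A μ Ω φ (grad φ) where
  memLp := memLp_testFunction φ
  memLp_grad := memLp_grad_testFunction φ
  isWeakGrad := isWeakGrad_testFunction φ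
  exists_approx := ⟨fun _ => φ, by simp, by simp⟩

theorem critExp_pos (hN : 4 ≤ N) : 0 < critExp N := by
  have : (4 : ℝ) ≤ N := by exact_mod_cast hN
  exact div_pos (by linarith) (by linarith)

/-- The product form survives `v = 0`, so approximating sequences need not be nonzero. -/
theorem mul_le_of_forall_ne {X F : Type*} [MeasurableSpace X] {ν : Measure X}
    [NormedAddCommGroup F] {v : X → F} {p r : ℝ} (hp : 0 < p) (hr : 0 < r) {c a : ℝ≥0∞}
    (h : ¬ v =ᵐ[ν] 0 → c ≤ a / (∫⁻ x, ‖v x‖ₑ ^ p ∂ν) ^ r) :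
    c * (∫⁻ x, ‖v x‖ₑ ^ p ∂ν) ^ r ≤ a := by
  by_cases h0 : v =ᵐ[ν] 0
  · have : ∫⁻ x, ‖v x‖ₑ ^ p ∂ν = 0 := by
      rw [lintegral_congr_ae (g := fun _ => 0)
        (by filter_upwards [h0] with x hx; simp [hx, hp])]
      simp
    simp [this, hr]
  · exact ENNReal.mul_le_of_le_div (h h0)

theorem sobolevConst_mul_le (hN : 4 ≤ N) (φ : 𝓓(Ω, ℝ)) :
    sobolevConst Ω * (∫⁻ x in (Ω : Set _), ‖φ x‖ₑ ^ critExp N) ^ (2 / critExp N) ≤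
      ∫⁻ x in (Ω : Set _), ‖grad φ x‖ₑ ^ 2 :=
  mul_le_of_forall_ne (critExp_pos hN) (div_pos two_pos (critExp_pos hN)) fun h =>
    iInf_le_of_le φ <| iInf_le_of_le (grad φ) <| iInf_le_of_le (memH10_testFunction φ) <|
      iInf_le _ h

theorem magSobolevConst_mul_le (hN : 4 ≤ N)
    (A : EuclideanSpace ℝ (Fin N) → EuclideanSpace ℝ (Fin N)) (μ : ℝ) (φ : 𝓓(Ω, ℂ)) :
    magSobolevConst A μ Ω * (∫⁻ x in (Ω : Set _), ‖φ x‖ₑ ^ critExp N) ^ (2 / critExp N) ≤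
      ∫⁻ x in (Ω : Set _), ‖magGrad A μ φ (grad φ) x‖ₑ ^ 2 :=
  mul_le_of_forall_ne (critExp_pos hN) (div_pos two_pos (critExp_pos hN)) fun h =>
    iInf_le_of_le φ <| iInf_le_of_le (grad φ) <| iInf_le_of_le (memMagH10_testFunction A μ φ) <|
      iInf_le _ h

end TestFunctions

/-! ### The diamagnetic inequality. -/

section Diamagnetic

variable {N : ℕ} {Ω : TopologicalSpace.Opens (EuclideanSpace ℝ (Fin N))}

/-- The smooth regularisation `√(|φ|² + ε²) - ε` of `|φ|`. -/
def regAbs (φ : 𝓓(Ω, ℂ)) (ε : ℝ) (hε : 0 < ε) : 𝓓(Ω, ℝ) where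
  -- `ε² > 0` keeps the root smooth; subtracting `ε` makes the function vanish wherever `φ` does.
  toFun x := √(‖φ x‖ ^ 2 + ε ^ 2) - ε
  contDiff' := by
    refine (ContDiff.sqrt ?_ fun x => ?_).sub contDiff_const
    · exact (φ.contDiff.norm_sq ℝ).add contDiff_const
    · positivity
  hasCompactSupport' := by
    refine φ.hasCompactSupport.mono fun x hx h => hx ?_
    simp [h, Real.sqrt_sq hε.le]
  tsupport_subset' := by
    refine (closure_mono (Function.support_subset_iff'.2 fun x hx => ?_)).trans φ.tsupport_subset
    simp [Function.notMem_support.1 hx, Real.sqrt_sq hε.le]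

theorem regAbs_apply (φ : 𝓓(Ω, ℂ)) (ε : ℝ) (hε : 0 < ε) (x : EuclideanSpace ℝ (Fin N)) :
    regAbs φ ε hε x = √(‖φ x‖ ^ 2 + ε ^ 2) - ε := rfl

theorem fderiv_regAbs (φ : 𝓓(Ω, ℂ)) (ε : ℝ) (hε : 0 < ε) (x v : EuclideanSpace ℝ (Fin N)) :
    fderiv ℝ (regAbs φ ε hε) x v =
      inner ℝ (φ x) (fderiv ℝ φ x v) / √(‖φ x‖ ^ 2 + ε ^ 2) := by
  have hφ : HasFDerivAt φ (fderiv ℝ φ x) x :=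
    (φ.contDiff.differentiable (by simp) x).hasFDerivAt
  have h := ((hφ.norm_sq.add_const (ε ^ 2)).sqrt (by positivity)).sub_const ε
  have h' : HasFDerivAt (regAbs φ ε hε) _ x := h
  rw [h'.fderiv]
  simp
  ring

/-- `i D_j φ = ∂_j φ - i A_j φ`, and `i A_j φ` is orthogonal to `φ` for the real inner product.
Hence `⟨φ, ∂_j φ⟩ = ⟨φ, i D_j φ⟩`, and Cauchy–Schwarz concludes. -/
theorem norm_grad_regAbs_le (A : EuclideanSpace ℝ (Fin N) → EuclideanSpace ℝ (Fin N)) (μ : ℝ)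
    (φ : 𝓓(Ω, ℂ)) (ε : ℝ) (hε : 0 < ε) (x : EuclideanSpace ℝ (Fin N)) :
    ‖grad (regAbs φ ε hε) x‖ ≤ ‖magGrad A μ φ (grad φ) x‖ := by
  rw [EuclideanSpace.norm_eq, EuclideanSpace.norm_eq]
  refine Real.sqrt_le_sqrt (Finset.sum_le_sum fun j _ => ?_)
  gcongr
  simp only [grad, magGrad, fderiv_regAbs]
  set w := fderiv ℝ φ x (EuclideanSpace.single j 1)
  set z := φ x
  set a := A (μ • x) j
  have hs : 0 < √(‖z‖ ^ 2 + ε ^ 2) := by positivity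
  have hz : ‖z‖ ≤ √(‖z‖ ^ 2 + ε ^ 2) := Real.le_sqrt_of_sq_le (by nlinarith)
  have h1 : inner ℝ z w = inner ℝ z (Complex.I * (-Complex.I * w - a * z)) := by
    simp [Complex.inner]
    ring
  rw [norm_div, Real.norm_of_nonneg hs.le, div_le_iff₀ hs, h1]
  calc _ ≤ ‖z‖ * ‖Complex.I * (-Complex.I * w - a * z)‖ := norm_inner_le_norm _ _
    _ = ‖-Complex.I * w - a * z‖ * ‖z‖ := by simp [mul_comm]
    _ ≤ _ := by gcongr

theorem tendsto_regAbs (φ : 𝓓(Ω, ℂ)) (x : EuclideanSpace ℝ (Fin N)) :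
    Tendsto (fun n : ℕ => regAbs φ (1 / ((n : ℝ) + 1)) Nat.one_div_pos_of_nat x) atTop
      (𝓝 ‖φ x‖) := by
  have h : Continuous fun ε : ℝ => √(‖φ x‖ ^ 2 + ε ^ 2) - ε := by fun_prop
  have := (h.tendsto 0).comp tendsto_one_div_add_atTop_nhds_zero_nat
  simpa [Function.comp_def, regAbs_apply] using this

/-- The diamagnetic inequality, in the form of a magnetic Sobolev inequality. -/
theorem sobolevConst_mul_le_magGrad (hN : 4 ≤ N)
    (A : EuclideanSpace ℝ (Fin N) → EuclideanSpace ℝ (Fin N)) (μ : ℝ) (φ : 𝓓(Ω, ℂ)) :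
    sobolevConst Ω * (∫⁻ x in (Ω : Set _), ‖φ x‖ₑ ^ critExp N) ^ (2 / critExp N) ≤
      ∫⁻ x in (Ω : Set _), ‖magGrad A μ φ (grad φ) x‖ₑ ^ 2 := by
  have := mul_lintegral_rpow_le_of_tendsto_ae (ν := volume.restrict (Ω : Set _))
    (u := fun n : ℕ => regAbs φ (1 / ((n : ℝ) + 1)) Nat.one_div_pos_of_nat)
    (v := fun x => ‖φ x‖) (p := critExp N) (r := 2 / critExp N) (c := sobolevConst Ω)
    (B := fun _ => ∫⁻ x in (Ω : Set _), ‖magGrad A μ φ (grad φ) x‖ₑ ^ 2)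
    (div_pos two_pos (critExp_pos hN)) (fun n => (memLp_testFunction _).1)
    (Eventually.of_forall fun x => tendsto_regAbs φ x) tendsto_const_nhds
    fun n => (sobolevConst_mul_le hN _).trans (lintegral_mono fun x => by
      gcongr
      exact enorm_le_iff_norm_le.2 (norm_grad_regAbs_le A μ φ _ _ x))
  simpa using this

end Diamagnetic

/-! ### Concentration at a point of `Ω`. -/

section Concentration

variable {N : ℕ} {Ω : TopologicalSpace.Opens (EuclideanSpace ℝ (Fin N))}

/-- The complex-valued function `x ↦ φ ((x - x₀) / σ)`. -/
def rescale (φ : EuclideanSpace ℝ (Fin N) → ℝ) (x₀ : EuclideanSpace ℝ (Fin N)) (σ : ℝ)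
    (x : EuclideanSpace ℝ (Fin N)) : ℂ := (φ (σ⁻¹ • (x - x₀)) : ℂ)

theorem grad_rescale {φ : EuclideanSpace ℝ (Fin N) → ℝ} (hφ : Differentiable ℝ φ)
    (x₀ : EuclideanSpace ℝ (Fin N)) (σ : ℝ) (x : EuclideanSpace ℝ (Fin N)) (j : Fin N) :
    grad (rescale φ x₀ σ) x j = ((σ⁻¹ * grad φ (σ⁻¹ • (x - x₀)) j : ℝ) : ℂ) := by
  have h1 : HasFDerivAt (fun x => σ⁻¹ • (x - x₀))
      (σ⁻¹ • ContinuousLinearMap.id ℝ (EuclideanSpace ℝ (Fin N))) x :=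
    ((hasFDerivAt_id x).sub_const x₀).const_smul σ⁻¹
  have h2 : HasFDerivAt (rescale φ x₀ σ) _ x := Complex.ofRealCLM.hasFDerivAt.comp x
    ((hφ (σ⁻¹ • (x - x₀))).hasFDerivAt.comp x h1)
  simp [grad, h2.fderiv]

/-- For real `φ` the two terms of `D_j` are purely imaginary and real, so their squares add up
exactly. -/
theorem norm_magGrad_rescale_sq_le {φ : EuclideanSpace ℝ (Fin N) → ℝ} (hφ : Differentiable ℝ φ)
    {A : EuclideanSpace ℝ (Fin N) → EuclideanSpace ℝ (Fin N)} {C : ℝ} (hC : ∀ x, ‖A x‖ ≤ C)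
    (μ : ℝ) (x₀ : EuclideanSpace ℝ (Fin N)) (σ : ℝ) (x : EuclideanSpace ℝ (Fin N)) :
    ‖magGrad A μ (rescale φ x₀ σ) (grad (rescale φ x₀ σ)) x‖ ^ 2 ≤
      (σ⁻¹) ^ 2 * ‖grad φ (σ⁻¹ • (x - x₀))‖ ^ 2 + C ^ 2 * ‖φ (σ⁻¹ • (x - x₀))‖ ^ 2 := by
  have key : ‖magGrad A μ (rescale φ x₀ σ) (grad (rescale φ x₀ σ)) x‖ ^ 2 =
      (σ⁻¹) ^ 2 * ‖grad φ (σ⁻¹ • (x - x₀))‖ ^ 2 +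
        ‖A (μ • x)‖ ^ 2 * ‖φ (σ⁻¹ • (x - x₀))‖ ^ 2 := by
    simp only [EuclideanSpace.norm_sq_eq, Finset.mul_sum, Finset.sum_mul,
      ← Finset.sum_add_distrib]
    refine Finset.sum_congr rfl fun j _ => ?_
    simp only [magGrad, grad_rescale hφ]
    rw [← Complex.normSq_eq_norm_sq, Complex.normSq_apply]
    simp [rescale]
    ring
  rw [key]
  gcongr
  exact hC _

theorem lintegral_comp_inv_smul_sub (f : EuclideanSpace ℝ (Fin N) → ℝ≥0∞) (hf : Measurable f)
    (x₀ : EuclideanSpace ℝ (Fin N)) {σ : ℝ} (hσ : 0 < σ) :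
    ∫⁻ x, f (σ⁻¹ • (x - x₀)) = ENNReal.ofReal σ ^ N * ∫⁻ x, f x := by
  rw [lintegral_sub_right_eq_self (fun x => f (σ⁻¹ • x)) x₀,
    ← lintegral_map (μ := volume) hf (measurable_const_smul σ⁻¹),
    Measure.map_addHaar_smul _ (inv_ne_zero hσ.ne'), lintegral_smul_measure]
  simp [abs_of_pos hσ, ENNReal.ofReal_pow hσ.le]

/-- The rescaled support lies in a ball of radius `σ * M` about `x₀`, where `M` bounds the support
of `φ`. -/
theorem eventually_exists_rescale (φ : 𝓓(Ω, ℝ)) {x₀ : EuclideanSpace ℝ (Fin N)} (hx₀ : x₀ ∈ Ω) :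
    ∀ᶠ σ in 𝓝[>] (0 : ℝ), ∃ ψ : 𝓓(Ω, ℂ), ⇑ψ = rescale φ x₀ σ := by
  obtain ⟨R, hR, hball⟩ := Metric.isOpen_iff.1 Ω.isOpen x₀ hx₀
  obtain ⟨M, hM0, hM⟩ := φ.hasCompactSupport.isCompact.isBounded.exists_pos_norm_le
  filter_upwards [Ioo_mem_nhdsGT (div_pos hR hM0)] with σ hσ
  have hσ0 : σ ≠ 0 := hσ.1.ne'
  have hσM : σ * M < R := (lt_div_iff₀ hM0).1 hσ.2
  have hts : Function.support (rescale φ x₀ σ) ⊆ Metric.closedBall x₀ (σ * M) := by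
    intro x hx
    have h1 : σ⁻¹ • (x - x₀) ∈ tsupport φ := subset_tsupport _ fun h => hx (by simp [rescale, h])
    have h2 := hM _ h1
    rw [norm_smul, norm_inv, Real.norm_of_nonneg hσ.1.le, inv_mul_le_iff₀ hσ.1] at h2
    rwa [mem_closedBall_iff_norm]
  refine ⟨⟨rescale φ x₀ σ, ?_, ?_, ?_⟩, rfl⟩
  · exact Complex.ofRealCLM.contDiff.comp (φ.contDiff.comp
      ((contDiff_id.sub contDiff_const).const_smul σ⁻¹))
  · exact HasCompactSupport.of_support_subset_isCompact (isCompact_closedBall _ _) hts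
  · exact (closure_minimal hts Metric.isClosed_closedBall).trans
      ((Metric.closedBall_subset_ball hσM).trans hball)

theorem setLIntegral_enorm_rpow_eq {F : Type*} [NormedAddCommGroup F]
    {s : Set (EuclideanSpace ℝ (Fin N))} (hs : MeasurableSet s)
    {f : EuclideanSpace ℝ (Fin N) → F} (hf : Function.support f ⊆ s) {p : ℝ} (hp : 0 < p) : ∫⁻ x in s, ‖f x‖ₑ ^ p = ∫⁻ x, ‖f x‖ₑ ^ p := by
  rw [← lintegral_indicator hs, Set.indicator_eq_self.2]
  refine fun x hx => hf fun h => hx ?_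
  simp [h, hp]

/-- Concentrating `φ` at a point makes the magnetic contribution negligible. -/
theorem magSobolevConst_mul_le_grad (hN : 4 ≤ N) (hΩ : (Ω : Set (EuclideanSpace ℝ (Fin N))).Nonempty)
    {A : EuclideanSpace ℝ (Fin N) → EuclideanSpace ℝ (Fin N)}
    {C : ℝ} (hC : ∀ x, ‖A x‖ ≤ C) (μ : ℝ) (φ : 𝓓(Ω, ℝ)) :
    magSobolevConst A μ Ω * (∫⁻ x in (Ω : Set _), ‖φ x‖ₑ ^ critExp N) ^ (2 / critExp N) ≤
      ∫⁻ x in (Ω : Set _), ‖grad φ x‖ₑ ^ 2 := by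
  obtain ⟨x₀, hx₀⟩ := hΩ
  have hp := critExp_pos hN
  have hφd : Differentiable ℝ φ := φ.contDiff.differentiable (by simp)
  set G := ∫⁻ x, ‖grad φ x‖ₑ ^ 2
  set B := ∫⁻ x, ‖φ x‖ₑ ^ 2
  set P := ∫⁻ x, ‖φ x‖ₑ ^ critExp N
  have hB : B ≠ ∞ := by
    have := (φ.continuous.memLp_of_hasCompactSupport (p := 2) (μ := volume)
      φ.hasCompactSupport).eLpNorm_ne_top
    simpa [B, ← eLpNorm_two_sq_eq_lintegral] using this
  have hG : ∫⁻ x in (Ω : Set _), ‖grad φ x‖ₑ ^ 2 = G := by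
    have := setLIntegral_enorm_rpow_eq Ω.isOpen.measurableSet
      ((support_grad_subset φ).trans φ.tsupport_subset) two_pos
    simpa using this
  rw [hG, setLIntegral_enorm_rpow_eq Ω.isOpen.measurableSet
    ((subset_tsupport _).trans φ.tsupport_subset) hp]
  have hev : ∀ᶠ σ in 𝓝[>] (0 : ℝ), magSobolevConst A μ Ω * P ^ (2 / critExp N) ≤
      G + ENNReal.ofReal σ ^ 2 * (ENNReal.ofReal (C ^ 2) * B) := by
    filter_upwards [eventually_exists_rescale φ hx₀, self_mem_nhdsWithin] with σ ⟨ψ, hψ⟩ hσ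
    replace hσ : 0 < σ := hσ
    have hs0 : ENNReal.ofReal σ ≠ 0 := by simpa using hσ
    have hst : ENNReal.ofReal σ ≠ ∞ := ENNReal.ofReal_ne_top
    have h := magSobolevConst_mul_le hN A μ ψ
    -- The exponent is `N · 2/2* = N - 2`: here criticality of `2*` enters.
    have hl : (∫⁻ x in (Ω : Set _), ‖ψ x‖ₑ ^ critExp N) ^ (2 / critExp N) =
        ENNReal.ofReal σ ^ (N - 2) * P ^ (2 / critExp N) := by
      rw [setLIntegral_enorm_rpow_eq Ω.isOpen.measurableSet
        ((subset_tsupport _).trans ψ.tsupport_subset) hp, hψ]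
      have := lintegral_comp_inv_smul_sub (fun x => ‖φ x‖ₑ ^ critExp N)
        (φ.continuous.measurable.enorm.pow_const _) x₀ hσ
      simp only [rescale, ← ofReal_norm (E := ℂ), Complex.norm_real, ofReal_norm]
      rw [this, ENNReal.mul_rpow_of_nonneg _ _ (div_pos two_pos hp).le, ← ENNReal.rpow_natCast,
        ← ENNReal.rpow_natCast, ← ENNReal.rpow_mul]
      congr 2
      have h4 : (4 : ℝ) ≤ N := by exact_mod_cast hN
      rw [Nat.cast_sub (by omega)]
      have : (N : ℝ) - 2 ≠ 0 := by linarith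
      unfold critExp
      push_cast
      field_simp
    have hr : ∫⁻ x in (Ω : Set _), ‖magGrad A μ ψ (grad ψ) x‖ₑ ^ 2 ≤
        ENNReal.ofReal σ ^ (N - 2) *
          (G + ENNReal.ofReal σ ^ 2 * (ENNReal.ofReal (C ^ 2) * B)) := by
      calc ∫⁻ x in (Ω : Set _), ‖magGrad A μ ψ (grad ψ) x‖ₑ ^ 2
          ≤ ∫⁻ x, ‖magGrad A μ ψ (grad ψ) x‖ₑ ^ 2 := setLIntegral_le_lintegral _ _
        _ ≤ ∫⁻ x, (fun y => ENNReal.ofReal (σ⁻¹ ^ 2) * ‖grad φ y‖ₑ ^ 2 +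
              ENNReal.ofReal (C ^ 2) * ‖φ y‖ₑ ^ 2) (σ⁻¹ • (x - x₀)) := by
            refine lintegral_mono fun x => ?_
            have := ENNReal.ofReal_le_ofReal (norm_magGrad_rescale_sq_le hφd hC μ x₀ σ x)
            rw [ENNReal.ofReal_add (by positivity) (by positivity),
              ENNReal.ofReal_mul (by positivity), ENNReal.ofReal_mul (by positivity),
              ENNReal.ofReal_pow (norm_nonneg _), ENNReal.ofReal_pow (norm_nonneg _),
              ENNReal.ofReal_pow (norm_nonneg _), ofReal_norm, ofReal_norm, ofReal_norm] at this
            rwa [hψ]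
        _ = ENNReal.ofReal σ ^ N * (ENNReal.ofReal (σ⁻¹ ^ 2) * G + ENNReal.ofReal (C ^ 2) * B) := by
            have m1 : Measurable fun y => ‖grad φ y‖ₑ ^ 2 :=
              (continuous_grad φ).measurable.enorm.pow_const 2
            have m2 : Measurable fun y => ‖φ y‖ₑ ^ 2 := φ.continuous.measurable.enorm.pow_const 2
            refine (lintegral_comp_inv_smul_sub _
                ((m1.const_mul _).add (m2.const_mul _)) x₀ hσ).trans ?_
            simp only [Pi.add_apply]
            rw [lintegral_add_left (m1.const_mul _), lintegral_const_mul _ m1,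
              lintegral_const_mul _ m2]
        _ = _ := by
            have h2 : ENNReal.ofReal σ ^ 2 * ENNReal.ofReal (σ⁻¹ ^ 2) = 1 := by
              rw [← ENNReal.ofReal_pow hσ.le, ← ENNReal.ofReal_mul (by positivity)]
              simp [hσ.ne']
            obtain ⟨k, rfl⟩ : ∃ k, N = k + 2 := ⟨N - 2, by omega⟩
            rw [Nat.add_sub_cancel, pow_add, mul_assoc, mul_add, ← mul_assoc, h2, one_mul]
    -- The common factor `σ^(N-2)` is finite and nonzero, hence cancels.
    rw [hl, mul_left_comm] at h
    exact (ENNReal.mul_le_mul_iff_right (pow_ne_zero _ hs0) (ENNReal.pow_ne_top hst)).1 (h.trans hr)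
  have hlim : Tendsto (fun σ : ℝ => G + ENNReal.ofReal σ ^ 2 * (ENNReal.ofReal (C ^ 2) * B))
      (𝓝[>] 0) (𝓝 G) := by
    -- Finiteness makes multiplication by this constant continuous at `0`.
    have hK : ENNReal.ofReal (C ^ 2) * B ≠ ∞ := ENNReal.mul_ne_top ENNReal.ofReal_ne_top hB
    have h : Continuous fun σ : ℝ => G + ENNReal.ofReal σ ^ 2 * (ENNReal.ofReal (C ^ 2) * B) :=
      continuous_const.add ((ENNReal.continuous_mul_const hK).comp
        ((ENNReal.continuous_pow 2).comp ENNReal.continuous_ofReal))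
    simpa using (h.tendsto 0).mono_left nhdsWithin_le_nhds
  exact ge_of_tendsto hlim hev

end Concentration

/-! ### Finite magnetic energy, and the conclusion. -/

theorem memLp_magGrad {N : ℕ} {ν : Measure (EuclideanSpace ℝ (Fin N))}
    {A : EuclideanSpace ℝ (Fin N) → EuclideanSpace ℝ (Fin N)} (hA : Continuous A)
    {C : ℝ} (hC : ∀ x, ‖A x‖ ≤ C) (μ : ℝ) {u : EuclideanSpace ℝ (Fin N) → ℂ}
    {g : EuclideanSpace ℝ (Fin N) → EuclideanSpace ℂ (Fin N)} (hu : MemLp u 2 ν)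
    (hg : MemLp g 2 ν) : MemLp (magGrad A μ u g) 2 ν := by
  refine (memLp_piLp_iff).2 fun j => ?_
  have hgj : MemLp (fun x => g x j) 2 ν := memLp_piLp_iff.1 hg j
  refine (hgj.const_mul (-Complex.I)).sub (hu.of_le_mul (c := C) (.mul ?_ hu.1) ?_)
  · exact Continuous.aestronglyMeasurable (by fun_prop)
  · refine Eventually.of_forall fun x => ?_
    rw [norm_mul, Complex.norm_real]
    gcongr
    exact (PiLp.norm_apply_le (A (μ • x)) j).trans (hC _)

end MagneticSobolev

end

theorem lemma2p1 (N : ℕ) (hN : 4 ≤ N)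
    (Ω : TopologicalSpace.Opens (EuclideanSpace ℝ (Fin N)))
    (hΩ : IsConnected (Ω : Set (EuclideanSpace ℝ (Fin N))))
    (hΩb : Bornology.IsBounded (Ω : Set (EuclideanSpace ℝ (Fin N))))
    (A : EuclideanSpace ℝ (Fin N) → EuclideanSpace ℝ (Fin N))
    (hA : Continuous A) (hAb : ∃ C : ℝ, ∀ x, ‖A x‖ ≤ C)
    (μ : ℝ) (hμ : 0 < μ) :
    MagneticSobolev.sobolevConst Ω = MagneticSobolev.magSobolevConst A μ Ω := by
  obtain ⟨C, hC⟩ := hAb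
  have hp := MagneticSobolev.critExp_pos hN
  have hr := div_pos two_pos hp
  refine le_antisymm (le_iInf₂ fun u g => le_iInf₂ fun hu hu0 => ?_)
    (le_iInf₂ fun u g => le_iInf₂ fun hu hu0 => ?_)
  -- The approximation is in the magnetic norm itself, so the limit energy is the required one, and
  -- `|u|` need not be shown to lie in `H¹₀`.
  · obtain ⟨φ, hφ, hφ'⟩ := hu.exists_approx
    have hD := MagneticSobolev.memLp_magGrad hA hC μ hu.memLp hu.memLp_grad
    refine MagneticSobolev.le_div_of_mul_lintegral_rpow_le hp hr hu.memLp.1 hu0 ?_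
      (MagneticSobolev.mul_lintegral_rpow_le_of_tendsto_eLpNorm hr
        (fun n => (MagneticSobolev.memLp_testFunction (φ n)).1) hu.memLp.1
        (fun n => (MagneticSobolev.memLp_magGrad hA hC μ
          (MagneticSobolev.memLp_testFunction (φ n))
          (MagneticSobolev.memLp_grad_testFunction (φ n))).1) hD.1 hφ hφ'
        fun n => MagneticSobolev.sobolevConst_mul_le_magGrad hN A μ (φ n))
    rw [← MagneticSobolev.eLpNorm_two_sq_eq_lintegral]
    exact ENNReal.pow_ne_top hD.eLpNorm_ne_top
  · obtain ⟨φ, hφ, hφ'⟩ := hu.exists_approx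
    refine MagneticSobolev.le_div_of_mul_lintegral_rpow_le hp hr hu.memLp.1 hu0 ?_
      (MagneticSobolev.mul_lintegral_rpow_le_of_tendsto_eLpNorm hr
        (fun n => (MagneticSobolev.memLp_testFunction (φ n)).1) hu.memLp.1
        (fun n => (MagneticSobolev.memLp_grad_testFunction (φ n)).1) hu.memLp_grad.1 hφ hφ'
        fun n => MagneticSobolev.magSobolevConst_mul_le_grad hN hΩ.nonempty hC μ (φ n))
    rw [← MagneticSobolev.eLpNorm_two_sq_eq_lintegral]
    exact ENNReal.pow_ne_top hu.memLp_grad.eLpNorm_ne_top
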